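/- Terms are generated by $M ::= x \mid \lambda x.M \mid MM \mid M\oplus M \mid \Omega$ and contexts by $C ::= [\cdot]\mid M\mid \lambda x.C\mid CM\mid MC\mid C\oplus C$. The affine judgement $\Gamma\vdash M$ ($\Gamma$ a finite set of variables) has the rules: $\Gamma,x\vdash x$; $\Gamma\vdash\Omega$; if $\Gamma,x\vdash M$ then $\Gamma\vdash\lambda x.M$; if $\Gamma\vdash M$ and $\Delta\vdash N$ with $\Gamma,\Delta$ disjoint then $\Gamma,\Delta\vdash MN$; if $\Gamma\vdash M$ and $\Gamma\vdash N$ then $\Gamma\vdash M\oplus N$. The same rules, together with $\Gamma\vdash[\cdot]$, define affine contexts. A program is a term $M$ with $\emptyset\vdash M$; a value is a program of the form $\lambda x.L$. The call-by-value semantics $[\![M]\!]$ of a program $M$ is the unique value subdistribution $\mathscr D$ with $M\Downarrow\mathscr D$, where $\Downarrow$ is given inductively by: $\Omega\Downarrow\emptyset$; $V\Downarrow\{V^1\}$ for a value $V$; if $M\Downarrow\mathscr D$ and $N\Downarrow\mathscr E$ then $M\oplus N\Downarrow\frac12\mathscr D+\frac12\mathscr E$; and if moreover $L\{V/x\}\Downarrow\mathscr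 F_{L,V}$ for all $\lambda x.L$ in the support of $\mathscr D$ and all $V$ in the support of $\mathscr E$, then $MN\Downarrow\sum\mathscr D(\lambda x.L)\,\mathscr E(V)\,\mathscr F_{L,V}$. The convergence probability of $M$ is $\sum[\![M]\!]=\sum_V[\![M]\!](V)$. For programs $M,N$, with $C$ ranging over the affine contexts $\emptyset\vdash C$, put $$\delta^{\mathrm{ctx}}(M,N)=\sup_C\Bigl|\textstyle\sum[\![C[M]]\!]-\sum[\![C[N]]\!]\Bigr|,\qquad M\le^{\mathrm{ctx}}N\iff\forall C:\ \textstyle\sum[\![C[M]]\!]\le\sum[\![C[N]]\!],$$ and let $M\equiv^{\mathrm{ctx}}N$ mean $M\le^{\mathrm{ctx}}N$ and $N\le^{\mathrm{ctx}}M$. A trace is a finite, possibly empty, sequence $s=@V_1\cdots @V_n$ of values. The probability $\Pr(M,s)$ that a program $M$ accepts $s$ is defined by $\Pr(\lambda x.L,\epsilon)=1$, $\Pr(\lambda x.L,@V\cdot s)=\Pr(L\{V/x\},s)$, and $\Pr(M,s)=\sum_V[\![M]\!](V)\Pr(V,s)$ if $M$ is not a value. Put $$\delta^{\mathrm{tr}}(M,N)=\sup_s|\Pr(M,s)-\Pr(N,s)|,$$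 $M\le^{\mathrm{tr}}N\iff\Pr(M,s)\le\Pr(N,s)$ for all traces $s$, and $M\equiv^{\mathrm{tr}}N\iff\Pr(M,s)=\Pr(N,s)$ for all traces $s$. **Theorem.** For all programs $M$ and $N$: $\delta^{\mathrm{ctx}}(M,N)=\delta^{\mathrm{tr}}(M,N)$; $M\le^{\mathrm{ctx}}N$ if and only if $M\le^{\mathrm{tr}}N$; and $M\equiv^{\mathrm{ctx}}N$ if and only if $M\equiv^{\mathrm{tr}}N$. -/

import Mathlib

open scoped ENNReal

namespace AffineLambda

/-- Terms `x | λx.M | M N | M ⊕ N | Ω`, with `ℕ` as the countable set of variables.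
Terms are kept as raw named syntax: only closed terms are ever substituted or put in a hole,
so no variable capture can occur and nothing below depends on the names of bound variables. -/
inductive Term : Type
  | var (x : ℕ) : Term
  | lam (x : ℕ) (M : Term) : Term
  | app (M N : Term) : Term
  | choice (M N : Term) : Term
  | omega : Term

/-- `M.subst x V` is `M{V/x}`, for a closed term `V`. -/
def Term.subst : Term → ℕ → Term → Term
  | .var y, x, V => if y = x then V else .var y
  | .lam y M, x, V => if y = x then .lam y M else .lam y (M.subst x V)
  | .app M N, x, V => .app (M.subst x V) (N.subst x V)
  | .choice M N, x, V => .choice (M.subst x V) (N.subst x V)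
  | .omega, _, _ => .omega

/-- The affine formation judgement `Γ ⊢ M`. In the rule for `λx.M` the variable `x` may already
occur in `Γ`; it is then shadowed, which agrees with first renaming the bound `x`. -/
inductive Affine : Finset ℕ → Term → Prop
  | var {Γ : Finset ℕ} {x : ℕ} : x ∈ Γ → Affine Γ (.var x)
  | lam {Γ : Finset ℕ} {x : ℕ} {M : Term} : Affine (insert x Γ) M → Affine Γ (.lam x M)
  | app {Γ Δ : Finset ℕ} {M N : Term} :
      Disjoint Γ Δ → Affine Γ M → Affine Δ N → Affine (Γ ∪ Δ) (.app M N)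
  | choice {Γ : Finset ℕ} {M N : Term} : Affine Γ M → Affine Γ N → Affine Γ (.choice M N)
  | omega {Γ : Finset ℕ} : Affine Γ .omega

theorem Affine.lam_inv {Γ : Finset ℕ} {x : ℕ} {M : Term} (h : Affine Γ (.lam x M)) :
    Affine (insert x Γ) M := by
  generalize hP : Term.lam x M = P at h
  cases h <;> cases hP
  assumption

theorem Affine.choice_inv {Γ : Finset ℕ} {M N : Term} (h : Affine Γ (.choice M N)) :
    Affine Γ M ∧ Affine Γ N := by
  generalize hP : Term.choice M N = P at h
  cases h <;> cases hP
  constructor <;> assumption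

theorem Affine.app_inv {M N : Term} (h : Affine ∅ (.app M N)) : Affine ∅ M ∧ Affine ∅ N := by
  generalize hP : Term.app M N = P at h
  generalize hΓ : (∅ : Finset ℕ) = Γ at h
  cases h with
  | app _ h1 h2 =>
    cases hP
    obtain ⟨e1, e2⟩ := Finset.union_eq_empty.1 hΓ.symm
    subst e1 e2
    exact ⟨h1, h2⟩
  | var | lam | choice | omega => cases hP

theorem Affine.not_var {x : ℕ} (h : Affine ∅ (.var x)) : False := by
  generalize hP : Term.var x = P at h
  generalize hΓ : (∅ : Finset ℕ) = Γ at h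
  cases h with
  | var hx => subst hΓ; simp at hx
  | app | lam | choice | omega => cases hP

theorem Affine.weaken {Γ : Finset ℕ} {M : Term} (h : Affine Γ M) :
    ∀ {Γ' : Finset ℕ}, Γ ⊆ Γ' → Affine Γ' M := by
  induction h with
  | var hx => intro Γ' hs; exact .var (hs hx)
  | lam _ ih => intro Γ' hs; exact .lam (ih (Finset.insert_subset_insert _ hs))
  | @app Γ Δ M N hd _ _ ihM ihN =>
    intro Γ' hs
    have hΓ : Γ ⊆ Γ' := Finset.union_subset_left hs
    have hΔ : Δ ⊆ Γ' \ Γ := by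
      intro a ha
      exact Finset.mem_sdiff.2 ⟨hs (Finset.mem_union_right _ ha),
        fun h' => Finset.disjoint_left.1 hd h' ha⟩
    have := Affine.app (Finset.disjoint_sdiff (s := Γ) (t := Γ')) (ihM (le_refl _)) (ihN hΔ)
    rwa [Finset.union_sdiff_of_subset hΓ] at this
  | choice _ _ ihM ihN => intro Γ' hs; exact .choice (ihM hs) (ihN hs)
  | omega => intro Γ' _; exact .omega

theorem Affine.subst {Γ : Finset ℕ} {M : Term} (h : Affine Γ M) (x : ℕ) {V : Term}
    (hV : Affine ∅ V) : Affine (Γ.erase x) (M.subst x V) := by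
  induction h with
  | @var Γ y hy =>
    unfold Term.subst
    split_ifs with hyx
    · exact hV.weaken (Finset.empty_subset _)
    · exact .var (Finset.mem_erase.2 ⟨hyx, hy⟩)
  | @lam Γ y M hM ih =>
    unfold Term.subst
    split_ifs with hyx
    · subst hyx
      refine .lam (hM.weaken ?_)
      intro a ha
      simp only [Finset.mem_insert, Finset.mem_erase] at ha ⊢
      tauto
    · refine .lam ?_
      rwa [Finset.erase_insert_of_ne hyx] at ih
  | app hd _ _ ihM ihN =>
    rw [Finset.erase_union_distrib]
    exact .app (hd.mono (Finset.erase_subset _ _) (Finset.erase_subset _ _)) ihM ihN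
  | choice _ _ ihM ihN => exact .choice ihM ihN
  | omega => exact .omega

/-- Programs: terms `M` with `∅ ⊢ M`. -/
def Program : Type := {M : Term // Affine ∅ M}

/-- Values: programs of the form `λx.L`. -/
@[ext] structure Value : Type where
  binder : ℕ
  body : Term
  affine : Affine ∅ (.lam binder body)

def Value.toProgram (V : Value) : Program := ⟨.lam V.binder V.body, V.affine⟩

def Program.app (M N : Program) : Program :=
  ⟨.app M.1 N.1, .app (Finset.disjoint_empty_left ∅) M.2 N.2⟩

def Program.choice (M N : Program) : Program := ⟨.choice M.1 N.1, .choice M.2 N.2⟩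

def Program.omega : Program := ⟨.omega, .omega⟩

/-- For `V = λx.L`, the program `L{W/x}`. -/
def Value.apply (V W : Value) : Program :=
  ⟨V.body.subst V.binder W.toProgram.1, by
    have hL : Affine (insert V.binder ∅) V.body := V.affine.lam_inv
    have := hL.subst V.binder W.toProgram.2
    simpa using this⟩

/-- Functions from values to `[0,∞]`. The ones that the semantics assigns to programs are value
subdistributions, see `BigStep.weight_le_one`. -/
abbrev ValueDist : Type := Value → ℝ≥0∞

open Classical in
/-- The Dirac value distribution `{V¹}`. -/
noncomputable def dirac (V : Value) : ValueDist := fun U => if U = V then 1 else 0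

/-- Big-step call-by-value evaluation `M ⇓ 𝒟`. -/
inductive BigStep : Program → ValueDist → Prop
  | omega : BigStep Program.omega (fun _ => 0)
  | value (V : Value) : BigStep V.toProgram (dirac V)
  | choice {M N : Program} {D E : ValueDist} : BigStep M D → BigStep N E →
      BigStep (M.choice N) (fun U => 2⁻¹ * D U + 2⁻¹ * E U)
  | app {M N : Program} {D E : ValueDist} {F : Value → Value → ValueDist} :
      BigStep M D → BigStep N E →
      (∀ V W : Value, D V ≠ 0 → E W ≠ 0 → BigStep (V.apply W) (F V W)) →
      BigStep (M.app N) (fun U => ∑' V : Value, ∑' W : Value, D V * E W * F V W U)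

/-! ### Evaluation is a function -/

theorem Program.app_inj {M N M' N' : Program} (h : M.app N = M'.app N') : M = M' ∧ N = N' := by
  have := congrArg Subtype.val h
  simp only [Program.app, Term.app.injEq] at this
  exact ⟨Subtype.ext this.1, Subtype.ext this.2⟩

theorem Program.choice_inj {M N M' N' : Program} (h : M.choice N = M'.choice N') :
    M = M' ∧ N = N' := by
  have := congrArg Subtype.val h
  simp only [Program.choice, Term.choice.injEq] at this
  exact ⟨Subtype.ext this.1, Subtype.ext this.2⟩

theorem Value.toProgram_inj {V W : Value} (h : V.toProgram = W.toProgram) : V = W := by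
  have := congrArg Subtype.val h
  simp only [Value.toProgram, Term.lam.injEq] at this
  exact Value.ext this.1 this.2

theorem BigStep.unique {M : Program} {D : ValueDist} (h : BigStep M D) :
    ∀ {D' : ValueDist}, BigStep M D' → D = D' := by
  induction h with
  | omega =>
    intro D' h'
    generalize hP : Program.omega = P at h'
    cases h' with
    | omega => rfl
    | value | choice | app => cases congrArg Subtype.val hP
  | value V =>
    intro D' h'
    generalize hP : V.toProgram = P at h'
    cases h' with
    | value W => rw [Value.toProgram_inj hP]
    | omega | choice | app => cases congrArg Subtype.val hP
  | choice _ _ ihM ihN =>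
    intro D' h'
    generalize hP : Program.choice _ _ = P at h'
    cases h' with
    | choice hM hN =>
      obtain ⟨rfl, rfl⟩ := Program.choice_inj hP
      rw [ihM hM, ihN hN]
    | omega | value | app => cases congrArg Subtype.val hP
  | @app M N D E F _ _ _ ihM ihN ihF =>
    intro D' h'
    generalize hP : Program.app _ _ = P at h'
    cases h' with
    | app hM hN hF =>
      obtain ⟨rfl, rfl⟩ := Program.app_inj hP
      obtain rfl := ihM hM
      obtain rfl := ihN hN
      funext U
      refine tsum_congr fun V => tsum_congr fun W => ?_
      by_cases hV : D V = 0
      · rw [hV]; simp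
      by_cases hW : E W = 0
      · rw [hW]; simp
      rw [ihF V W hV hW (hF V W hV hW)]
    | omega | value | choice => cases congrArg Subtype.val hP

theorem Affine.subst_eq_self {Γ : Finset ℕ} {M : Term} (h : Affine Γ M) {x : ℕ} (hx : x ∉ Γ)
    (V : Term) : M.subst x V = M := by
  induction h with
  | @var Γ y hy =>
    have : y ≠ x := fun e => hx (e ▸ hy)
    simp [Term.subst, this]
  | @lam Γ y M _ ih =>
    unfold Term.subst
    split_ifs with hyx
    · rfl
    · rw [ih (by simp [hx, Ne.symm hyx])]
  | app _ _ _ ihM ihN =>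
    simp only [Finset.mem_union, not_or] at hx
    simp [Term.subst, ihM hx.1, ihN hx.2]
  | choice _ _ ihM ihN => simp [Term.subst, ihM hx, ihN hx]
  | omega => rfl

/-- A measure that decreases in evaluation; used to see that every program has a semantics. -/
def Term.rank : Term → ℕ
  | .var _ => 1
  | .lam _ M => M.rank + 1
  | .app M N => M.rank + N.rank + 1
  | .choice M N => max M.rank N.rank + 1
  | .omega => 1

theorem Affine.rank_subst_le {Γ : Finset ℕ} {M : Term} (h : Affine Γ M) (x : ℕ) (V : Term) :
    (M.subst x V).rank ≤ M.rank + V.rank := by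
  induction h with
  | @var Γ y hy =>
    unfold Term.subst
    split_ifs <;> simp [Term.rank]
  | @lam Γ y M _ ih =>
    unfold Term.subst
    split_ifs <;> simp only [Term.rank] <;> omega
  | @app Γ Δ M N hd hM hN ihM ihN =>
    simp only [Term.subst, Term.rank]
    by_cases hx : x ∈ Γ
    · rw [hN.subst_eq_self (Finset.disjoint_left.1 hd hx)]; omega
    · rw [hM.subst_eq_self hx]; omega
  | choice _ _ ihM ihN => simp only [Term.subst, Term.rank]; omega
  | omega => simp [Term.subst, Term.rank]

theorem Value.rank_apply_lt (V W : Value) :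
    (V.apply W).1.rank < V.toProgram.1.rank + W.toProgram.1.rank := by
  have hL : Affine (insert V.binder ∅) V.body := V.affine.lam_inv
  have := hL.rank_subst_le V.binder W.toProgram.1
  simp only [Value.apply, Value.toProgram, Term.rank] at this ⊢
  omega

theorem BigStep.exists_of_rank (n : ℕ) : ∀ M : Program, M.1.rank ≤ n →
    ∃ D : ValueDist, BigStep M D ∧ ∀ V : Value, D V ≠ 0 → V.toProgram.1.rank ≤ M.1.rank := by
  induction n with
  | zero => rintro ⟨M, hM⟩ h; cases M <;> simp [Term.rank] at h
  | succ n ih =>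
    rintro ⟨M, hM⟩ h
    cases M with
    | var x => exact hM.not_var.elim
    | omega => exact ⟨_, BigStep.omega, fun V hV => absurd rfl hV⟩
    | lam x L =>
      refine ⟨_, BigStep.value ⟨x, L, hM⟩, fun V hV => ?_⟩
      have : V = ⟨x, L, hM⟩ := by
        by_contra hne
        exact hV (by simp [dirac, hne])
      rw [this]; rfl
    | choice P Q =>
      have hP : Affine ∅ P := hM.choice_inv.1
      have hQ : Affine ∅ Q := hM.choice_inv.2
      simp only [Term.rank] at h
      obtain ⟨D, hD, hDr⟩ := ih ⟨P, hP⟩ (by simp only; omega)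
      obtain ⟨E, hE, hEr⟩ := ih ⟨Q, hQ⟩ (by simp only; omega)
      refine ⟨_, BigStep.choice hD hE, fun V hV => ?_⟩
      simp only [Term.rank]
      by_cases hDV : D V = 0
      · by_cases hEV : E V = 0
        · simp [hDV, hEV] at hV
        · have := hEr V hEV; simp only at this; omega
      · have := hDr V hDV; simp only at this; omega
    | app P Q =>
      obtain ⟨hP, hQ⟩ := hM.app_inv
      simp only [Term.rank] at h
      obtain ⟨D, hD, hDr⟩ := ih ⟨P, hP⟩ (by simp only; omega)
      obtain ⟨E, hE, hEr⟩ := ih ⟨Q, hQ⟩ (by simp only; omega)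
      simp only at hDr hEr
      have key : ∀ V W : Value, ∃ G : ValueDist, D V ≠ 0 → E W ≠ 0 →
          BigStep (V.apply W) G ∧
            ∀ U : Value, G U ≠ 0 → U.toProgram.1.rank ≤ (V.apply W).1.rank := by
        intro V W
        by_cases hc : D V ≠ 0 ∧ E W ≠ 0
        · have h1 := hDr V hc.1
          have h2 := hEr W hc.2
          have h3 := Value.rank_apply_lt V W
          obtain ⟨G, hG⟩ := ih (V.apply W) (by omega)
          exact ⟨G, fun _ _ => hG⟩
        · exact ⟨fun _ => 0, fun a b => absurd ⟨a, b⟩ hc⟩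
      choose F hF using key
      refine ⟨_, BigStep.app hD hE (fun V W hV hW => (hF V W hV hW).1), fun U hU => ?_⟩
      have hU' : ∃ V W, D V * E W * F V W U ≠ 0 := by
        by_contra hcon
        push Not at hcon
        exact hU (by simp [hcon])
      obtain ⟨V, W, hVW⟩ := hU'
      have hV : D V ≠ 0 := fun e => hVW (by simp [e])
      have hW : E W ≠ 0 := fun e => hVW (by simp [e])
      have hFU : F V W U ≠ 0 := fun e => hVW (by simp [e])
      have h1 := hDr V hV
      have h2 := hEr W hW
      have h3 := Value.rank_apply_lt V W
      have h4 := (hF V W hV hW).2 U hFU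
      simp only [Term.rank]
      omega

/-- Every program evaluates to exactly one value distribution. -/
theorem BigStep.existsUnique (M : Program) : ∃! D : ValueDist, BigStep M D := by
  obtain ⟨D, hD, _⟩ := BigStep.exists_of_rank _ M le_rfl
  exact ⟨D, hD, fun D' h' => h'.unique hD⟩

/-- The semantics `⟦M⟧`: the unique value distribution with `M ⇓ ⟦M⟧`. -/
noncomputable def sem (M : Program) : ValueDist := (BigStep.existsUnique M).choose

theorem sem_spec (M : Program) : BigStep M (sem M) := (BigStep.existsUnique M).choose_spec.1

theorem BigStep.weight_le_one {M : Program} {D : ValueDist} (h : BigStep M D) :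
    ∑' V : Value, D V ≤ 1 := by
  induction h with
  | omega => simp
  | value V => simp [dirac]
  | choice _ _ ihM ihN =>
    rw [ENNReal.tsum_add, ENNReal.tsum_mul_left, ENNReal.tsum_mul_left]
    calc _ ≤ (2⁻¹ : ℝ≥0∞) * 1 + 2⁻¹ * 1 := by gcongr
      _ = 1 := by simp [ENNReal.inv_two_add_inv_two]
  | @app M N D E F _ _ _ ihM ihN ihF =>
    calc ∑' U, ∑' V, ∑' W, D V * E W * F V W U
        = ∑' V, ∑' W, D V * E W * ∑' U, F V W U := by
          rw [ENNReal.tsum_comm]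
          refine tsum_congr fun V => ?_
          rw [ENNReal.tsum_comm]
          exact tsum_congr fun W => ENNReal.tsum_mul_left
      _ ≤ ∑' V, ∑' W, D V * E W := by
          refine ENNReal.tsum_le_tsum fun V => ENNReal.tsum_le_tsum fun W => ?_
          by_cases hV : D V = 0
          · simp [hV]
          by_cases hW : E W = 0
          · simp [hW]
          exact mul_le_of_le_one_right' (ihF V W hV hW)
      _ = (∑' V, D V) * ∑' W, E W := by
          simp_rw [ENNReal.tsum_mul_left, ENNReal.tsum_mul_right]
      _ ≤ 1 := mul_le_one' ihM ihN

/-- The convergence probability of `M`: the weight of `⟦M⟧`. -/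
noncomputable def convProb (M : Program) : ℝ := (∑' V : Value, sem M V).toReal

theorem convProb_mem (M : Program) : convProb M ∈ Set.Icc (0 : ℝ) 1 :=
  ⟨ENNReal.toReal_nonneg, ENNReal.toReal_le_of_le_ofReal zero_le_one
    (by simpa using (sem_spec M).weight_le_one)⟩

/-! ### Contexts -/

/-- Contexts `[·] | M | λx.C | C M | M C | C ⊕ C`. -/
inductive Ctx : Type
  | hole : Ctx
  | term (M : Term) : Ctx
  | lam (x : ℕ) (C : Ctx) : Ctx
  | appL (C : Ctx) (M : Term) : Ctx
  | appR (M : Term) (C : Ctx) : Ctx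
  | choice (C D : Ctx) : Ctx

/-- The affine formation judgement for contexts. -/
inductive AffineCtx : Finset ℕ → Ctx → Prop
  | hole {Γ : Finset ℕ} : AffineCtx Γ .hole
  | term {Γ : Finset ℕ} {M : Term} : Affine Γ M → AffineCtx Γ (.term M)
  | lam {Γ : Finset ℕ} {x : ℕ} {C : Ctx} : AffineCtx (insert x Γ) C → AffineCtx Γ (.lam x C)
  | appL {Γ Δ : Finset ℕ} {C : Ctx} {M : Term} :
      Disjoint Γ Δ → AffineCtx Γ C → Affine Δ M → AffineCtx (Γ ∪ Δ) (.appL C M)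
  | appR {Γ Δ : Finset ℕ} {M : Term} {C : Ctx} :
      Disjoint Γ Δ → Affine Γ M → AffineCtx Δ C → AffineCtx (Γ ∪ Δ) (.appR M C)
  | choice {Γ : Finset ℕ} {C D : Ctx} :
      AffineCtx Γ C → AffineCtx Γ D → AffineCtx Γ (.choice C D)

/-- `C.fill M` replaces every hole of `C` by the closed term `M`. -/
def Ctx.fill (M : Term) : Ctx → Term
  | .hole => M
  | .term N => N
  | .lam x C => .lam x (Ctx.fill M C)
  | .appL C N => .app (Ctx.fill M C) N
  | .appR N C => .app N (Ctx.fill M C)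
  | .choice C D => .choice (Ctx.fill M C) (Ctx.fill M D)

theorem AffineCtx.fill {Γ : Finset ℕ} {C : Ctx} (h : AffineCtx Γ C) {M : Term}
    (hM : Affine ∅ M) : Affine Γ (C.fill M) := by
  induction h with
  | hole => exact hM.weaken (Finset.empty_subset _)
  | term hN => exact hN
  | lam _ ih => exact .lam ih
  | appL hd _ hN ih => exact .app hd ih hN
  | appR hd hN _ ih => exact .app hd hN ih
  | choice _ _ ihC ihD => exact .choice ihC ihD

/-- Affine contexts without free variables: those for which `C[M]` is a program. -/
def ProgCtx : Type := {C : Ctx // AffineCtx ∅ C}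

/-- The program `C[M]`. -/
def ProgCtx.fill (C : ProgCtx) (M : Program) : Program := ⟨C.1.fill M.1, C.2.fill M.2⟩

/-- The context preorder. -/
def CtxLE (M N : Program) : Prop :=
  ∀ C : ProgCtx, convProb (C.fill M) ≤ convProb (C.fill N)

/-- Context equivalence. -/
def CtxEquiv (M N : Program) : Prop := CtxLE M N ∧ CtxLE N M

/-- The context distance. -/
noncomputable def ctxDist (M N : Program) : ℝ :=
  ⨆ C : ProgCtx, |convProb (C.fill M) - convProb (C.fill N)|

/-! ### Traces -/

/-- A trace `@V₁ ⋯ @Vₙ` is a finite sequence of values. -/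
abbrev Trace : Type := List Value

/-- Extend to programs a quantity `f` defined on values:
`f(V)` on a value `V`, and `∑_V ⟦M⟧(V) · f(V)` on a program `M` that is not a value. -/
noncomputable def extendToProgram (f : Value → ℝ≥0∞) : Program → ℝ≥0∞
  | ⟨.lam x L, h⟩ => f ⟨x, L, h⟩
  | M => ∑' V : Value, sem M V * f V

/-- Probability that a value accepts a trace:
`Pr(λx.L, ε) = 1` and `Pr(λx.L, @W · s) = Pr(L{W/x}, s)`. -/
noncomputable def valueTraceProb : Trace → Value → ℝ≥0∞
  | [], _ => 1
  | W :: s, V => extendToProgram (valueTraceProb s) (V.apply W)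

/-- Probability that a program accepts a trace, in `[0,∞]`. -/
noncomputable def traceProbENN (M : Program) (s : Trace) : ℝ≥0∞ :=
  extendToProgram (valueTraceProb s) M

theorem traceProbENN_value_nil (V : Value) : traceProbENN V.toProgram [] = 1 := rfl

theorem traceProbENN_value_cons (V W : Value) (s : Trace) :
    traceProbENN V.toProgram (W :: s) = traceProbENN (V.apply W) s := rfl

theorem traceProbENN_of_not_value (M : Program) (hM : ∀ V : Value, M ≠ V.toProgram) (s : Trace) :
    traceProbENN M s = ∑' V : Value, sem M V * traceProbENN V.toProgram s := by
  obtain ⟨M, h⟩ := M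
  cases M with
  | lam x L => exact absurd rfl (hM ⟨x, L, h⟩)
  | _ => rfl

theorem extendToProgram_le_one {f : Value → ℝ≥0∞} (hf : ∀ V, f V ≤ 1) (M : Program) :
    extendToProgram f M ≤ 1 := by
  have key : ∑' V : Value, sem M V * f V ≤ 1 :=
    (ENNReal.tsum_le_tsum fun V => mul_le_of_le_one_right' (hf V)).trans
      (sem_spec M).weight_le_one
  obtain ⟨M, h⟩ := M
  cases M with
  | lam x L => exact hf _
  | _ => exact key

theorem traceProbENN_le_one (M : Program) (s : Trace) : traceProbENN M s ≤ 1 := by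
  refine extendToProgram_le_one ?_ M
  induction s with
  | nil => exact fun _ => le_rfl
  | cons W s ih => exact fun V => extendToProgram_le_one ih _

/-- Probability that the program `M` accepts the trace `s`. -/
noncomputable def traceProb (M : Program) (s : Trace) : ℝ := (traceProbENN M s).toReal

theorem traceProb_mem (M : Program) (s : Trace) : traceProb M s ∈ Set.Icc (0 : ℝ) 1 :=
  ⟨ENNReal.toReal_nonneg, ENNReal.toReal_le_of_le_ofReal zero_le_one
    (by simpa using traceProbENN_le_one M s)⟩

/-- The trace preorder. -/
def TraceLE (M N : Program) : Prop := ∀ s : Trace, traceProb M s ≤ traceProb N s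

/-- Trace equivalence. -/
def TraceEquiv (M N : Program) : Prop := ∀ s : Trace, traceProb M s = traceProb N s

/-- The trace distance. -/
noncomputable def traceDist (M N : Program) : ℝ :=
  ⨆ s : Trace, |traceProb M s - traceProb N s|

/-- The supremum in `ctxDist` is a genuine one. -/
theorem bddAbove_ctxDist (M N : Program) :
    BddAbove (Set.range fun C : ProgCtx => |convProb (C.fill M) - convProb (C.fill N)|) := by
  refine ⟨1, ?_⟩
  rintro _ ⟨C, rfl⟩
  have h1 := convProb_mem (C.fill M)
  have h2 := convProb_mem (C.fill N)
  exact abs_sub_le_iff.2 ⟨by linarith [h1.2, h2.1], by linarith [h1.1, h2.2]⟩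

/-- The supremum in `traceDist` is a genuine one. -/
theorem bddAbove_traceDist (M N : Program) :
    BddAbove (Set.range fun s : Trace => |traceProb M s - traceProb N s|) := by
  refine ⟨1, ?_⟩
  rintro _ ⟨s, rfl⟩
  have h1 := traceProb_mem M s
  have h2 := traceProb_mem N s
  exact abs_sub_le_iff.2 ⟨by linarith [h1.2, h2.1], by linarith [h1.1, h2.2]⟩

end AffineLambda

open AffineLambda

/-!
Every context acts on programs as a *random test*: the convergence probability of `C[M]` is a
mixture, with weights depending on `C` only, of the probabilities that `M` accepts a trace and of
the constant `1`. Such mixtures cannot separate `M` from `N` by more than the traces do.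

To prove this by induction on `C`, one replaces convergence by the expectation of an arbitrary
continuation `f` on values, since evaluating `A[M] N` amounts to evaluating `A[M]` with the
continuation `V ↦ 𝔼 f (V N)`. The continuation is itself required to act as a random test on the
program in the hole and on the contexts `λx.K` to which `C[M]` may evaluate. The induction
terminates because, by affinity, β-reduction decreases the total rank. Conversely, the trace
`@V₁ ⋯ @Vₙ` is the context `[·] V₁ ⋯ Vₙ`.
-/

open scoped NNReal

namespace AffineLambda

/-! ### Expectations under the semantics -/

theorem BigStep.sem_eq {M : Program} {D : ValueDist} (h : BigStep M D) : sem M = D :=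
  (sem_spec M).unique h

theorem rank_le_of_sem_ne_zero {M : Program} {V : Value} (h : sem M V ≠ 0) :
    V.toProgram.1.rank ≤ M.1.rank := by
  obtain ⟨D, hD, hrank⟩ := BigStep.exists_of_rank _ M le_rfl
  exact hrank V (hD.sem_eq ▸ h)

theorem tsum_dirac_mul (f : Value → ℝ≥0∞) (V : Value) : ∑' U : Value, dirac V U * f U = f V := by
  rw [tsum_eq_single V fun U hU => by simp [dirac, hU]]
  simp [dirac]

theorem extendToProgram_eq_tsum (f : Value → ℝ≥0∞) (M : Program) :
    extendToProgram f M = ∑' V : Value, sem M V * f V := by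
  obtain ⟨M, hM⟩ := M
  cases M with
  | lam x L =>
    have hsem : sem ⟨.lam x L, hM⟩ = dirac ⟨x, L, hM⟩ := (BigStep.value ⟨x, L, hM⟩).sem_eq
    rw [hsem, tsum_dirac_mul]
    rfl
  | _ => rfl

theorem extendToProgram_choice (f : Value → ℝ≥0∞) (M N : Program) :
    extendToProgram f (M.choice N) = 2⁻¹ * extendToProgram f M + 2⁻¹ * extendToProgram f N := by
  simp only [extendToProgram_eq_tsum, (BigStep.choice (sem_spec M) (sem_spec N)).sem_eq, add_mul,
    mul_assoc, ENNReal.tsum_add, ENNReal.tsum_mul_left]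

theorem extendToProgram_tsum_mul {κ : Type*} (w : κ → ℝ≥0∞) (φ : κ → Value → ℝ≥0∞) (M : Program) :
    extendToProgram (fun V => ∑' k, w k * φ k V) M = ∑' k, w k * extendToProgram (φ k) M := by
  simp only [extendToProgram_eq_tsum, ← ENNReal.tsum_mul_left]
  rw [ENNReal.tsum_comm]
  exact tsum_congr fun k => tsum_congr fun V => mul_left_comm _ _ _

theorem extendToProgram_app (f : Value → ℝ≥0∞) (M N : Program) :
    extendToProgram f (M.app N) =
      extendToProgram (fun V => extendToProgram (fun W => extendToProgram f (V.apply W)) N) M := by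
  have hsem := (BigStep.app (sem_spec M) (sem_spec N) fun V W _ _ => sem_spec (V.apply W)).sem_eq
  simp only [extendToProgram_eq_tsum, hsem, ← ENNReal.tsum_mul_right, ← ENNReal.tsum_mul_left]
  rw [ENNReal.tsum_comm]
  refine tsum_congr fun V => ?_
  rw [ENNReal.tsum_comm]
  exact tsum_congr fun W => tsum_congr fun U => by rw [mul_assoc, mul_assoc]

theorem extendToProgram_app_values (f : Value → ℝ≥0∞) (V W : Value) :
    extendToProgram f (V.toProgram.app W.toProgram) = extendToProgram f (V.apply W) :=
  extendToProgram_app f V.toProgram W.toProgram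

theorem extendToProgram_app_left (f : Value → ℝ≥0∞) (M N : Program) :
    extendToProgram f (M.app N) =
      extendToProgram (fun V => extendToProgram f (V.toProgram.app N)) M := by
  rw [extendToProgram_app]
  congr 1
  funext V
  exact (extendToProgram_app f V.toProgram N).symm

theorem extendToProgram_app_right (f : Value → ℝ≥0∞) (M N : Program) :
    extendToProgram f (M.app N) =
      extendToProgram (fun W => extendToProgram f (M.app W.toProgram)) N := by
  have hvalue (W : Value) : extendToProgram f (M.app W.toProgram) =
      ∑' V, sem M V * extendToProgram f (V.apply W) := by
    rw [extendToProgram_app, extendToProgram_eq_tsum]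
    rfl
  simp only [hvalue, extendToProgram_tsum_mul]
  rw [extendToProgram_app, extendToProgram_eq_tsum]

theorem extendToProgram_app_comm (f : Value → ℝ≥0∞) (M N : Program) :
    extendToProgram (fun V => extendToProgram f (V.toProgram.app N)) M =
      extendToProgram (fun W => extendToProgram f (M.app W.toProgram)) N := by
  rw [← extendToProgram_app_left, extendToProgram_app_right]

theorem traceProbENN_app_value (M : Program) (W : Value) (s : Trace) :
    traceProbENN (M.app W.toProgram) s = traceProbENN M (W :: s) :=
  extendToProgram_app (valueTraceProb s) M W.toProgram

theorem convProb_eq_traceProb_nil (M : Program) : convProb M = traceProb M [] := by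
  simp [convProb, traceProb, traceProbENN, extendToProgram_eq_tsum, valueTraceProb]

/-! ### Program contexts -/

namespace ProgCtx

/-- The context `[·]`. -/
def hole : ProgCtx := ⟨.hole, .hole⟩

/-- The constant context `N`. -/
def term (N : Program) : ProgCtx := ⟨.term N.1, .term N.2⟩

/-- The context `C N`. -/
def appL (C : ProgCtx) (N : Program) : ProgCtx :=
  ⟨.appL C.1 N.1, .appL (Finset.disjoint_empty_left ∅) C.2 N.2⟩

/-- The context `N C`. -/
def appR (N : Program) (C : ProgCtx) : ProgCtx :=
  ⟨.appR N.1 C.1, .appR (Finset.disjoint_empty_left ∅) N.2 C.2⟩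

/-- The context `C ⊕ D`. -/
def choice (C D : ProgCtx) : ProgCtx := ⟨.choice C.1 D.1, .choice C.2 D.2⟩

/-- The size of a context, with a hole counted as `Ω`, that is, as `1`. -/
def rank (C : ProgCtx) : ℕ := (C.fill Program.omega).1.rank

/-- The context `C V₁ ⋯ Vₙ`, which runs the trace `@V₁ ⋯ @Vₙ` on the program in the context `C`. -/
def appTrace (C : ProgCtx) (s : Trace) : ProgCtx := s.foldl (fun C V => C.appL V.toProgram) C

variable (M N : Program) (C D : ProgCtx)

theorem fill_hole : hole.fill M = M := rfl

theorem fill_appL : (C.appL N).fill M = (C.fill M).app N := rfl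

theorem fill_appR : (appR N C).fill M = N.app (C.fill M) := rfl

theorem fill_choice : (C.choice D).fill M = (C.fill M).choice (D.fill M) := rfl

theorem rank_hole : hole.rank = 1 := rfl

theorem rank_appL : (C.appL N).rank = C.rank + N.1.rank + 1 := rfl

theorem rank_appR : (appR N C).rank = N.1.rank + C.rank + 1 := rfl

theorem rank_choice : (C.choice D).rank = max C.rank D.rank + 1 := rfl

end ProgCtx

theorem convProb_fill_appTrace (C : ProgCtx) (s : Trace) (M : Program) :
    convProb ((C.appTrace s).fill M) = traceProb (C.fill M) s := by
  induction s generalizing C with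
  | nil => exact convProb_eq_traceProb_nil _
  | cons W s ih =>
    calc convProb (((C.appL W.toProgram).appTrace s).fill M)
        = traceProb ((C.fill M).app W.toProgram) s := ih _
      _ = traceProb (C.fill M) (W :: s) :=
          congrArg ENNReal.toReal (traceProbENN_app_value (C.fill M) W s)

/-- Contexts `λx.K` without free variables, the counterpart of `Value`. -/
structure ValueCtx : Type where
  binder : ℕ
  body : Ctx
  affine : AffineCtx ∅ (.lam binder body)

/-- A value context as a program context. -/
def ValueCtx.toProgCtx (K : ValueCtx) : ProgCtx := ⟨.lam K.binder K.body, K.affine⟩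

/-- The value `λx.K[M]`. -/
def ValueCtx.fill (K : ValueCtx) (M : Program) : Value :=
  ⟨K.binder, K.body.fill M.1, K.affine.fill M.2⟩

@[elab_as_elim]
theorem ProgCtx.cases {p : ProgCtx → Prop} (C : ProgCtx) (hole : p hole) (term : ∀ N, p (term N))
    (lam : ∀ K : ValueCtx, p K.toProgCtx) (appL : ∀ A N, p (appL A N))
    (appR : ∀ N A, p (appR N A)) (choice : ∀ A B, p (choice A B)) : p C := by
  obtain ⟨C, hC⟩ := C
  have hcases {Γ : Finset ℕ} {C : Ctx} (h : AffineCtx Γ C) :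
      Γ = ∅ → ∀ hC : AffineCtx ∅ C, p ⟨C, hC⟩ := by
    cases h with
    | hole => exact fun _ _ => hole
    | term hN => rintro rfl _; exact term ⟨_, hN⟩
    | lam hK => rintro rfl _; exact lam ⟨_, _, .lam hK⟩
    | appL _ hA hN =>
      intro hΓ _
      obtain ⟨rfl, rfl⟩ := Finset.union_eq_empty.1 hΓ
      exact appL ⟨_, hA⟩ ⟨_, hN⟩
    | appR _ hN hA =>
      intro hΓ _
      obtain ⟨rfl, rfl⟩ := Finset.union_eq_empty.1 hΓ
      exact appR ⟨_, hN⟩ ⟨_, hA⟩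
    | choice hA hB => rintro rfl _; exact choice ⟨_, hA⟩ ⟨_, hB⟩
  exact hcases hC rfl hC

/-! ### Substitution and contexts -/

/-- `C.subst x V` is `C{V/x}`, for a closed term `V`. -/
def Ctx.subst : Ctx → ℕ → Term → Ctx
  | .hole, _, _ => .hole
  | .term M, x, V => .term (M.subst x V)
  | .lam y C, x, V => if y = x then .lam y C else .lam y (C.subst x V)
  | .appL C M, x, V => .appL (C.subst x V) (M.subst x V)
  | .appR M C, x, V => .appR (M.subst x V) (C.subst x V)
  | .choice C D, x, V => .choice (C.subst x V) (D.subst x V)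

theorem Ctx.fill_subst (C : Ctx) (x : ℕ) (V : Term) {M : Term} (hM : Affine ∅ M) :
    (C.subst x V).fill M = (C.fill M).subst x V := by
  induction C with
  | hole => exact (hM.subst_eq_self (Finset.notMem_empty x) V).symm
  | term N => rfl
  | lam y C ih =>
    by_cases hyx : y = x
    · simp [Ctx.subst, Ctx.fill, Term.subst, hyx]
    · simp [Ctx.subst, Ctx.fill, Term.subst, hyx, ih]
  | appL C N ih | appR N C ih => simp [Ctx.subst, Ctx.fill, Term.subst, ih]
  | choice C D ihC ihD => simp [Ctx.subst, Ctx.fill, Term.subst, ihC, ihD]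

theorem AffineCtx.lam_inv {Γ : Finset ℕ} {x : ℕ} {C : Ctx} (h : AffineCtx Γ (.lam x C)) :
    AffineCtx (insert x Γ) C := by
  cases h
  assumption

theorem AffineCtx.weaken {Γ Γ' : Finset ℕ} {C : Ctx} (h : AffineCtx Γ C) (hs : Γ ⊆ Γ') :
    AffineCtx Γ' C := by
  induction h generalizing Γ' with
  | hole => exact .hole
  | term hM => exact .term (hM.weaken hs)
  | lam _ ih => exact .lam (ih (Finset.insert_subset_insert _ hs))
  | @appL Γ Δ _ _ hd _ hN ih =>
    rw [← Finset.sdiff_union_of_subset (Finset.union_subset_right hs)]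
    exact .appL Finset.sdiff_disjoint
      (ih (Finset.subset_sdiff.2 ⟨Finset.union_subset_left hs, hd⟩)) hN
  | @appR Γ Δ _ _ hd hN _ ih =>
    rw [← Finset.union_sdiff_of_subset (Finset.union_subset_left hs)]
    exact .appR Finset.disjoint_sdiff hN
      (ih (Finset.subset_sdiff.2 ⟨Finset.union_subset_right hs, hd.symm⟩))
  | choice _ _ ihC ihD => exact .choice (ihC hs) (ihD hs)

theorem AffineCtx.subst {Γ : Finset ℕ} {C : Ctx} (h : AffineCtx Γ C) (x : ℕ) {V : Term}
    (hV : Affine ∅ V) : AffineCtx (Γ.erase x) (C.subst x V) := by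
  induction h with
  | hole => exact .hole
  | term hM => exact .term (hM.subst x hV)
  | @lam Γ y C hC ih =>
    by_cases hyx : y = x
    · subst hyx
      rw [Ctx.subst, if_pos rfl]
      exact .lam (hC.weaken (Finset.insert_subset (Finset.mem_insert_self y _)
        (Finset.insert_erase_subset y Γ)))
    · rw [Ctx.subst, if_neg hyx]
      exact .lam (by rwa [Finset.erase_insert_of_ne hyx] at ih)
  | appL hd _ hN ih =>
    rw [Finset.erase_union_distrib]
    exact .appL (hd.mono (Finset.erase_subset _ _) (Finset.erase_subset _ _)) ih (hN.subst x hV)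
  | appR hd hN _ ih =>
    rw [Finset.erase_union_distrib]
    exact .appR (hd.mono (Finset.erase_subset _ _) (Finset.erase_subset _ _)) (hN.subst x hV) ih
  | choice _ _ ihC ihD => exact .choice ihC ihD

/-- The value-context analogue of `Value.apply`: for `K = λx.C`, the context `C{W/x}`. -/
def ValueCtx.apply (K : ValueCtx) (W : Value) : ProgCtx :=
  ⟨K.body.subst K.binder W.toProgram.1, by
    simpa using K.affine.lam_inv.subst K.binder W.toProgram.2⟩

theorem ValueCtx.fill_apply (K : ValueCtx) (W : Value) (M : Program) :
    (K.apply W).fill M = (K.fill M).apply W :=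
  Subtype.ext (K.body.fill_subst K.binder W.toProgram.1 M.2)

theorem ValueCtx.rank_apply_lt (K : ValueCtx) (W : Value) :
    (K.apply W).rank < K.toProgCtx.rank + W.toProgram.1.rank := by
  rw [ProgCtx.rank, K.fill_apply]
  exact Value.rank_apply_lt _ W

-- Affinity lets at most one side of an application mention `x`, so that `L{K/x}` is a context.
theorem Affine.exists_substCtx {Γ : Finset ℕ} {L : Term} (h : Affine Γ L) (x : ℕ) {K : Ctx}
    (hK : AffineCtx ∅ K) :
    ∃ C : Ctx, AffineCtx (Γ.erase x) C ∧ ∀ M : Term, C.fill M = L.subst x (K.fill M) := by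
  induction h with
  | @var Γ y hy =>
    by_cases hyx : y = x
    · exact ⟨K, hK.weaken (Finset.empty_subset _), fun M => by simp [Term.subst, hyx]⟩
    · exact ⟨.term (.var y), .term (.var (Finset.mem_erase.2 ⟨hyx, hy⟩)),
        fun M => by simp [Ctx.fill, Term.subst, hyx]⟩
  | @lam Γ y L hL ih =>
    by_cases hyx : y = x
    · subst hyx
      have hL' : Affine (insert y (Γ.erase y)) L :=
        hL.weaken (Finset.insert_subset (Finset.mem_insert_self y _)
          (Finset.insert_erase_subset y Γ))
      exact ⟨.term (.lam y L), .term (.lam hL'), fun M => by simp [Ctx.fill, Term.subst]⟩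
    · obtain ⟨C, hC, hfill⟩ := ih
      exact ⟨.lam y C, .lam (by rwa [Finset.erase_insert_of_ne hyx] at hC),
        fun M => by simp [Ctx.fill, Term.subst, hyx, hfill]⟩
  | @app Γ Δ P Q hd hP hQ ihP ihQ =>
    have hd' := hd.mono (Finset.erase_subset x Γ) (Finset.erase_subset x Δ)
    rw [Finset.erase_union_distrib]
    by_cases hxΓ : x ∈ Γ
    · have hxΔ : x ∉ Δ := Finset.disjoint_left.1 hd hxΓ
      obtain ⟨C, hC, hfill⟩ := ihP
      exact ⟨.appL C Q, .appL hd' hC (by rwa [Finset.erase_eq_of_notMem hxΔ]),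
        fun M => by simp [Ctx.fill, Term.subst, hfill, hQ.subst_eq_self hxΔ]⟩
    · obtain ⟨C, hC, hfill⟩ := ihQ
      exact ⟨.appR P C, .appR hd' (by rwa [Finset.erase_eq_of_notMem hxΓ]) hC,
        fun M => by simp [Ctx.fill, Term.subst, hfill, hP.subst_eq_self hxΓ]⟩
  | choice _ _ ihP ihQ =>
    obtain ⟨C, hC, hfillC⟩ := ihP
    obtain ⟨D, hD, hfillD⟩ := ihQ
    exact ⟨.choice C D, .choice hC hD, fun M => by simp [Ctx.fill, Term.subst, hfillC, hfillD]⟩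
  | omega => exact ⟨.term .omega, .term .omega, fun _ => rfl⟩

theorem Value.exists_progCtx_apply (V : Value) (C : ProgCtx) :
    ∃ D : ProgCtx, D.rank < V.toProgram.1.rank + C.rank ∧
      ∀ (M : Program) (W : Value), W.toProgram = C.fill M → D.fill M = V.apply W := by
  have hbody := V.affine.lam_inv
  obtain ⟨D, hD, hfill⟩ := hbody.exists_substCtx V.binder C.2
  refine ⟨⟨D, by simpa using hD⟩, ?_, fun M W hW => Subtype.ext ?_⟩
  · have hrank := hbody.rank_subst_le V.binder (C.1.fill .omega)
    rw [← hfill] at hrank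
    exact Nat.lt_of_le_of_lt hrank (Nat.add_lt_add_right (Nat.lt_succ_self _) _)
  · simp only [Value.apply, hW, ProgCtx.fill, hfill]

/-! ### Random tests -/

/-- `φ M` is the probability that `M` passes a random test: with probabilities that do not depend
on `M`, either a trace is run on `M`, or `M` passes outright. -/
inductive IsRandomTest : (Program → ℝ≥0∞) → Prop
  | one : IsRandomTest fun _ => 1
  | trace (s : Trace) : IsRandomTest fun M => traceProbENN M s
  | tsum {κ : Type} {w : κ → ℝ≥0∞} {φ : κ → Program → ℝ≥0∞} :
      ∑' k, w k ≤ 1 → (∀ k, IsRandomTest (φ k)) → IsRandomTest fun M => ∑' k, w k * φ k M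

namespace IsRandomTest

variable {φ ψ : Program → ℝ≥0∞}

theorem le_add (h : IsRandomTest φ) {M N : Program} {δ : ℝ≥0∞}
    (hMN : ∀ s, traceProbENN M s ≤ traceProbENN N s + δ) : φ M ≤ φ N + δ := by
  induction h with
  | one => exact le_self_add
  | trace s => exact hMN s
  | @tsum κ w φ hw _ ih =>
    calc ∑' k, w k * φ k M
        ≤ ∑' k, w k * (φ k N + δ) := by gcongr with k; exact ih k
      _ = ∑' k, w k * φ k N + (∑' k, w k) * δ := by
          simp only [mul_add, ENNReal.tsum_add, ENNReal.tsum_mul_right]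
      _ ≤ ∑' k, w k * φ k N + δ := by gcongr; exact mul_le_of_le_one_left' hw

theorem le_one (h : IsRandomTest φ) (M : Program) : φ M ≤ 1 := by
  induction h with
  | one => exact le_rfl
  | trace s => exact traceProbENN_le_one M s
  | tsum hw _ ih =>
    exact (ENNReal.tsum_le_tsum fun k => mul_le_of_le_one_right' (ih k)).trans hw

theorem const {c : ℝ≥0∞} (hc : c ≤ 1) : IsRandomTest fun _ => c := by
  simpa using tsum (κ := Unit) (w := fun _ => c) (by simpa using hc) fun _ => one

theorem average (hφ : IsRandomTest φ) (hψ : IsRandomTest ψ) :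
    IsRandomTest fun M => 2⁻¹ * φ M + 2⁻¹ * ψ M := by
  simpa using tsum (κ := Bool) (w := fun _ => 2⁻¹) (φ := fun b => cond b φ ψ)
    (by simp) (Bool.rec hψ hφ)

theorem extend {φ : Value → Program → ℝ≥0∞} (N : Program)
    (h : ∀ W, sem N W ≠ 0 → IsRandomTest (φ W)) :
    IsRandomTest fun M => extendToProgram (fun W => φ W M) N := by
  classical
  convert tsum (sem_spec N).weight_le_one
    (φ := fun W => if sem N W = 0 then fun _ => 1 else φ W) fun W => ?_ using 2 with M
  · rw [extendToProgram_eq_tsum]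
    refine tsum_congr fun W => ?_
    split_ifs with hW
    · simp [hW]
    · rfl
  · split_ifs with hW
    · exact one
    · exact h W hW

theorem app_value (h : IsRandomTest φ) (W : Value) :
    IsRandomTest fun M => φ (M.app W.toProgram) := by
  induction h with
  | one => exact one
  | trace s => simpa only [traceProbENN_app_value] using trace (W :: s)
  | tsum hw _ ih => exact tsum hw ih

/-- Evaluation turns the test that every value passes into the trace `ε`. -/
theorem eval (h : IsRandomTest φ) :
    IsRandomTest fun M => extendToProgram (fun V => φ V.toProgram) M := by
  induction h with
  | one => exact trace []
  | trace s => exact trace s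
  | tsum hw _ ih => simpa only [extendToProgram_tsum_mul] using tsum hw ih

end IsRandomTest

/-! ### Evaluation in context -/

/-- A continuation `f` is testable up to rank `n` if running it on the program in a hole, or on a
value context of rank at most `n`, is a random test. -/
structure IsTestable (f : Value → ℝ≥0∞) (n : ℕ) : Prop where
  hole : IsRandomTest (extendToProgram f)
  valueCtx : ∀ K : ValueCtx, K.toProgCtx.rank ≤ n → IsRandomTest fun M => f (K.fill M)

namespace IsTestable

variable {f : Value → ℝ≥0∞} {m n : ℕ}

theorem mono (hf : IsTestable f n) (hmn : m ≤ n) : IsTestable f m :=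
  ⟨hf.hole, fun K hK => hf.valueCtx K (hK.trans hmn)⟩

theorem app_left (hf : IsRandomTest (extendToProgram f))
    (hfill : ∀ C : ProgCtx, C.rank < n → IsRandomTest fun M => extendToProgram f (C.fill M))
    {N : Program} (hrank : m + N.1.rank < n) :
    IsTestable (fun V => extendToProgram f (V.toProgram.app N)) m where
  hole := by
    rw [funext fun M => extendToProgram_app_comm f M N]
    exact .extend N fun W _ => hf.app_value W
  valueCtx K hK := by
    simp only [extendToProgram_app_right (N := N), extendToProgram_app_values, ← K.fill_apply]
    refine .extend N fun W hW => hfill _ ?_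
    have := K.rank_apply_lt W
    have := rank_le_of_sem_ne_zero hW
    omega

theorem app_right
    (hfill : ∀ C : ProgCtx, C.rank < n → IsRandomTest fun M => extendToProgram f (C.fill M))
    {N : Program} (hrank : N.1.rank + m < n) :
    IsTestable (fun W => extendToProgram f (N.app W.toProgram)) m where
  hole := by
    rw [funext fun M => (extendToProgram_app_comm f N M).symm]
    refine .extend N fun V hV => ?_
    obtain ⟨D, hD, hfillD⟩ := V.exists_progCtx_apply .hole
    have heval (M : Program) : extendToProgram f (V.toProgram.app M) =
        extendToProgram (fun W => extendToProgram f (D.fill W.toProgram)) M := by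
      rw [extendToProgram_app_right]
      simp only [extendToProgram_app_values, hfillD _ _ (ProgCtx.fill_hole _).symm]
    simp only [heval]
    refine (hfill D ?_).eval
    have := rank_le_of_sem_ne_zero hV
    have := ProgCtx.rank_hole
    omega
  valueCtx K hK := by
    simp only [extendToProgram_app_left (M := N), extendToProgram_app_values]
    refine .extend N fun V hV => ?_
    obtain ⟨D, hD, hfillD⟩ := V.exists_progCtx_apply K.toProgCtx
    simp only [← hfillD _ (K.fill _) rfl]
    refine hfill D ?_
    have := rank_le_of_sem_ne_zero hV
    omega

theorem isRandomTest_fill (C : ProgCtx) (hf : IsTestable f C.rank) :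
    IsRandomTest fun M => extendToProgram f (C.fill M) := by
  induction hn : C.rank using Nat.strong_induction_on generalizing C f with
  | _ n ih =>
  subst hn
  have hfill (D : ProgCtx) (hD : D.rank < C.rank) :
      IsRandomTest fun M => extendToProgram f (D.fill M) := ih _ hD D (hf.mono hD.le) rfl
  cases C using ProgCtx.cases with
  | hole => exact hf.hole
  | term N => exact .const (hf.hole.le_one N)
  | lam K => exact hf.valueCtx K le_rfl
  | appL A N =>
    have hrank := ProgCtx.rank_appL N A
    have hg : IsTestable (fun V => extendToProgram f (V.toProgram.app N)) A.rank :=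
      app_left hf.hole hfill (by omega)
    simpa only [ProgCtx.fill_appL, ← extendToProgram_app_left] using ih _ (by omega) A hg rfl
  | appR N A =>
    have hrank := ProgCtx.rank_appR N A
    have hg : IsTestable (fun W => extendToProgram f (N.app W.toProgram)) A.rank :=
      app_right hfill (by omega)
    simpa only [ProgCtx.fill_appR, ← extendToProgram_app_right] using ih _ (by omega) A hg rfl
  | choice A B =>
    have hrank := ProgCtx.rank_choice A B
    simpa only [ProgCtx.fill_choice, extendToProgram_choice] using
      (hfill A (by omega)).average (hfill B (by omega))

end IsTestable

theorem ProgCtx.isRandomTest_convergence (C : ProgCtx) :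
    IsRandomTest fun M => traceProbENN (C.fill M) [] :=
  IsTestable.isRandomTest_fill C ⟨.trace [], fun _ _ => .one⟩

/-! ### Comparison of contexts and traces -/

theorem traceProbENN_ne_top (M : Program) (s : Trace) : traceProbENN M s ≠ ∞ :=
  ne_top_of_le_ne_top ENNReal.one_ne_top (traceProbENN_le_one M s)

theorem traceProb_le_add_iff {M N : Program} {s : Trace} {δ : ℝ≥0} :
    traceProb M s ≤ traceProb N s + δ ↔ traceProbENN M s ≤ traceProbENN N s + δ := by
  rw [← ENNReal.toReal_le_toReal (traceProbENN_ne_top M s)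
    (ENNReal.add_ne_top.2 ⟨traceProbENN_ne_top N s, ENNReal.coe_ne_top⟩),
    ENNReal.toReal_add (traceProbENN_ne_top N s) ENNReal.coe_ne_top]
  rfl

theorem convProb_fill_le_add {M N : Program} {δ : ℝ≥0}
    (h : ∀ s, traceProb M s ≤ traceProb N s + δ) (C : ProgCtx) :
    convProb (C.fill M) ≤ convProb (C.fill N) + δ := by
  simp only [traceProb_le_add_iff, convProb_eq_traceProb_nil] at h ⊢
  exact C.isRandomTest_convergence.le_add h

theorem ctxLE_iff_traceLE (M N : Program) : CtxLE M N ↔ TraceLE M N := by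
  constructor
  · intro h s
    simpa only [convProb_fill_appTrace, ProgCtx.fill_hole] using h (ProgCtx.hole.appTrace s)
  · intro h C
    simpa using convProb_fill_le_add (δ := 0) (fun s => by simpa using h s) C

theorem ctxEquiv_iff_traceEquiv (M N : Program) : CtxEquiv M N ↔ TraceEquiv M N := by
  simp only [CtxEquiv, ctxLE_iff_traceLE, TraceLE, TraceEquiv, ← forall_and, le_antisymm_iff]

theorem ctxDist_le_traceDist (M N : Program) : ctxDist M N ≤ traceDist M N := by
  have hle (s : Trace) : |traceProb M s - traceProb N s| ≤ traceDist M N :=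
    le_ciSup (bddAbove_traceDist M N) s
  lift traceDist M N to ℝ≥0 using Real.iSup_nonneg fun _ => abs_nonneg _ with δ
  refine Real.iSup_le (fun C => abs_sub_le_iff.2 ⟨?_, ?_⟩) δ.2
  · exact sub_le_iff_le_add'.2 <| convProb_fill_le_add
      (fun s => sub_le_iff_le_add'.1 (abs_sub_le_iff.1 (hle s)).1) C
  · exact sub_le_iff_le_add'.2 <| convProb_fill_le_add
      (fun s => sub_le_iff_le_add'.1 (abs_sub_le_iff.1 (hle s)).2) C

theorem traceDist_le_ctxDist (M N : Program) : traceDist M N ≤ ctxDist M N := by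
  refine ciSup_le fun s => ?_
  have hle (C : ProgCtx) : |convProb (C.fill M) - convProb (C.fill N)| ≤ ctxDist M N :=
    le_ciSup (bddAbove_ctxDist M N) C
  simpa only [convProb_fill_appTrace, ProgCtx.fill_hole] using hle (ProgCtx.hole.appTrace s)

end AffineLambda

theorem mainTheorem2 :
    (∀ M N : Program, ctxDist M N = traceDist M N) ∧
    (∀ M N : Program, CtxLE M N ↔ TraceLE M N) ∧
    (∀ M N : Program, CtxEquiv M N ↔ TraceEquiv M N) :=
  ⟨fun M N => le_antisymm (ctxDist_le_traceDist M N) (traceDist_le_ctxDist M N),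
    ctxLE_iff_traceLE, ctxEquiv_iff_traceEquiv⟩
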